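/- **Setting.** Consider a static team with $N$ decision makers. Nature draws $\omega_0\in\Omega_0$ with law $P$; given $\omega_0$, the measurements $y^i\in\mathbb{Y}^i$ are drawn independently from stochastic kernels $g^i(dy^i|\omega_0)$, and $\mu(d\omega_0,d\mathbf y)=P(d\omega_0)\prod_i g^i(dy^i|\omega_0)$. The actions are $u^i=\gamma^i(y^i)\in\mathbb{U}^i$ with $\gamma^i$ measurable; $\mathbf\Gamma$ is the set of such strategies $\underline\gamma=(\gamma^1,\dots,\gamma^N)$. For a measurable cost $c(\omega_0,\mathbf y,\mathbf u)\ge 0$ let $J(\underline\gamma)=\int c(\omega_0,\mathbf y,\underline\gamma(\mathbf y))\,d\mu\in[0,\infty]$ and $J^*=\inf_{\underline\gamma\in\mathbf\Gamma}J(\underline\gamma)$. The strategic measure induced by $\underline\gamma$ is the law of $(\omega_0,(y^k,\gamma^k(y^k))_{k=1}^N)$ on $\Omega_0\times\prod_{k=1}^N(\mathbb{Y}^k\times\mathbb{U}^k)$; the cost of such a measure $P$ is $\int c\,dP$. For $G\subset\prod_k\mathbb{U}^k$ let $w_G(\omega_0,\mathbf y)=\sup_{\mathbf u\in G}c(\omega_0,\mathbf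 y,\mathbf u)$. **Quantizers.** Each $\mathbb{Y}^i$ is a separable metric space with metric $d_i$, with compact sets $K^i_l\subset\operatorname{int}K^i_{l+1}$, $\bigcup_lK^i_l=\mathbb{Y}^i$ $(l\ge 1)$. For $l,n\ge1$, $\mathbb{Y}^i_{l,n}\subset K^i_l$ is a finite $1/n$-net of $K_l^i$ (every $y\in K^i_l$ is at distance less than $1/n$ from $\mathbb{Y}^i_{l,n}$), and $Q^i_{l,n}$ maps each $y\in K_l^i$ to a nearest point of $\mathbb{Y}^i_{l,n}$ (ties broken measurably) and every $y\notin K^i_l$ to an auxiliary point $y_{i,0}\in\mathbb{Y}^i$. The finite-measurement $(l,n)$ team has the same $P$ and action spaces, measurement spaces $\mathbb{Z}^i_{l,n}=\mathbb{Y}^i_{l,n}\cup\{y_{i,0}\}$, as channels the push-forwards of $g^i(\cdot|\omega_0)$ under $Q^i_{l,n}$, and as cost the restriction of $c$; $\mu_{l,n}$ is its joint law of $(\omega_0,\mathbf y)$. For $G=\prod_iG^i$ compact, $T_A^G(\mu_{l,n})$ is the set of strategic measures of the $(l,n)$ team induced by measurable policies whose support on $\prod_k\mathbb{U}^k$ is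 contained in $G$. **Assumptions.** 1. (a) $c$ is continuous in $(\mathbf u,\mathbf y)$ for each fixed $\omega_0$ and bounded on compact subsets of $\Omega_0\times\prod_k(\mathbb{Y}^k\times\mathbb{U}^k)$. (b) Each $\mathbb{U}^k$ is a nonempty, separable, closed and convex subset of a completely metrizable locally convex vector space. (c) Each $\mathbb{Y}^k$ is locally compact. (d) $w_G$ is $\mu$-integrable for every compact $G=\prod_kG^k\subset\prod_k\mathbb{U}^k$. (e) For every $\underline\gamma\in\mathbf\Gamma$ with $J(\underline\gamma)<\infty$ and every $k$ there is $u^{k,*}\in\mathbb{U}^k$ such that replacing $\gamma^k$ by the constant policy $u^{k,*}$ gives a strategy of finite cost. 2. For every compact $G=\prod_kG^k\subset\prod_k\mathbb{U}^k$, $\displaystyle\lim_{R\to\infty}\sup_{l,n}\int_{\{w_G>R\}}w_G\,d\mu_{l,n}=0.$ **Theorem.** Let $\varepsilon>0$ and $0\le\delta<\varepsilon$. There exist $(l,n)$ and a compact $G=\prod_iG^i\subset\prod_k\mathbb{U}^k$ such that * the set $T_A^G(\mu_{l,n})$ contains an optimal element, i.e. one of minimal cost in the $(l,n)$ team; and *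 whenever a strategic measure in $T_A^G(\mu_{l,n})$, induced by policies $\gamma^k:\mathbb{Z}^k_{l,n}\to\mathbb{U}^k$, is $\delta$-optimal (its cost is at most $\delta$ more than that of every element of $T_A^G(\mu_{l,n})$; $\delta=0$ means optimal), its extension through the quantizers, i.e. the strategic measure $P_{\mathrm{ex}}$ of the original team induced by $\gamma^k\circ Q^k_{l,n}$, is $\varepsilon$-optimal for the original team: $$\int c\,dP_{\mathrm{ex}}\le J^*+\varepsilon .$$ -/

import Mathlib

open MeasureTheory ProbabilityTheory Filter Topology
open scoped NNReal ENNReal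

noncomputable section

/-- The kernel `ω ↦ ⨂ᵢ gᵢ(· | ω)`: the coordinates are drawn independently given `ω`. -/
def piKernel {N : ℕ} {Ω₀ : Type*} [MeasurableSpace Ω₀] {Y : Fin N → Type*}
    [∀ i, MeasurableSpace (Y i)] (g : ∀ i, Kernel Ω₀ (Y i)) [∀ i, IsMarkovKernel (g i)] :
    Kernel Ω₀ (∀ i, Y i) where
  toFun ω := Measure.pi fun i => g i ω
  measurable' := by
    refine Measurable.measure_of_isPiSystem_of_isProbabilityMeasure generateFrom_pi.symm
      isPiSystem_pi ?_
    rintro _ ⟨s, hs, rfl⟩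
    simp only [Measure.pi_pi]
    exact Finset.measurable_prod _ fun i _ => (g i).measurable_coe (hs i (Set.mem_univ i))

instance piKernel.instIsMarkovKernel {N : ℕ} {Ω₀ : Type*} [MeasurableSpace Ω₀]
    {Y : Fin N → Type*} [∀ i, MeasurableSpace (Y i)] (g : ∀ i, Kernel Ω₀ (Y i))
    [∀ i, IsMarkovKernel (g i)] : IsMarkovKernel (piKernel g) :=
  ⟨fun ω => inferInstanceAs (IsProbabilityMeasure (Measure.pi fun i => g i ω))⟩

/-- A static team with `N` decision makers: `prior` is the law of the exogenous variable `ω₀`,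
`channel i` is the measurement channel `gⁱ(dyⁱ | ω₀)` of decision maker `i`, and
`c ω₀ y u` is the nonnegative measurable cost. -/
structure StaticTeam {N : ℕ} (Ω₀ : Type*) [MeasurableSpace Ω₀]
    (Y : Fin N → Type*) [∀ i, MeasurableSpace (Y i)]
    (U : Fin N → Type*) [∀ i, MeasurableSpace (U i)] where
  prior : Measure Ω₀
  isProbabilityMeasure_prior : IsProbabilityMeasure prior
  channel : ∀ i, Kernel Ω₀ (Y i)
  isMarkovKernel_channel : ∀ i, IsMarkovKernel (channel i)
  c : Ω₀ → (∀ i, Y i) → (∀ i, U i) → ℝ≥0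
  measurable_c : Measurable fun s : Ω₀ × (∀ i, Y i) × (∀ i, U i) => c s.1 s.2.1 s.2.2

attribute [instance] StaticTeam.isProbabilityMeasure_prior StaticTeam.isMarkovKernel_channel

namespace StaticTeam

section

variable {N : ℕ} {Ω₀ : Type*} [MeasurableSpace Ω₀] {Y : Fin N → Type*}
  [∀ i, MeasurableSpace (Y i)] {U : Fin N → Type*} [∀ i, MeasurableSpace (U i)]

/-- The joint law `μ(dω₀, dy) = P(dω₀) ∏ᵢ gⁱ(dyⁱ | ω₀)` of `(ω₀, y)`. -/
def law (T : StaticTeam Ω₀ Y U) : Measure (Ω₀ × ∀ i, Y i) :=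
  T.prior ⊗ₘ piKernel T.channel

/-- Admissible strategies `γ = (γ¹, …, γᴺ)`: each `γⁱ` is a measurable function of `yⁱ`. -/
abbrev Strategy (_T : StaticTeam Ω₀ Y U) : Type _ :=
  ∀ i, {γ : Y i → U i // Measurable γ}

/-- The expected cost `J(γ) = E[c(ω₀, y, γ(y))]`, possibly infinite. -/
def J (T : StaticTeam Ω₀ Y U) (γ : T.Strategy) : ℝ≥0∞ :=
  ∫⁻ x, (T.c x.1 x.2 (fun i => (γ i).1 (x.2 i)) : ℝ≥0∞) ∂T.law

/-- The optimal team cost `J* = inf_γ J(γ)`. -/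
def optimalCost (T : StaticTeam Ω₀ Y U) : ℝ≥0∞ :=
  ⨅ γ : T.Strategy, T.J γ

/-- The strategic measure induced by `γ`: the law of `(ω₀, (yᵏ, γᵏ(yᵏ))ₖ)`. -/
def strategicMeasure (T : StaticTeam Ω₀ Y U) (γ : T.Strategy) :
    Measure (Ω₀ × ∀ i, Y i × U i) :=
  T.law.map fun x => (x.1, fun i => (x.2 i, (γ i).1 (x.2 i)))

/-- On cylinder sets the strategic measure is given by
`P(B) = ∫_{B⁰ × ∏ Aᵏ} μ(dω₀, dy) ∏ₖ 1{γᵏ(yᵏ) ∈ Bᵏ}`. -/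
theorem strategicMeasure_cylinder (T : StaticTeam Ω₀ Y U) (γ : T.Strategy)
    {B₀ : Set Ω₀} (hB₀ : MeasurableSet B₀) {A : ∀ i, Set (Y i)} (hA : ∀ i, MeasurableSet (A i))
    {B : ∀ i, Set (U i)} (hB : ∀ i, MeasurableSet (B i)) :
    T.strategicMeasure γ (B₀ ×ˢ Set.univ.pi fun i => A i ×ˢ B i) =
      ∫⁻ x in B₀ ×ˢ Set.univ.pi A,
        ∏ i, ((γ i).1 ⁻¹' B i).indicator (fun _ => (1 : ℝ≥0∞)) (x.2 i) ∂T.law := by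
  have hγ : ∀ i, Measurable (γ i).1 := fun i => (γ i).2
  have hm : Measurable fun x : Ω₀ × (∀ i, Y i) =>
      (x.1, fun i => (x.2 i, (γ i).1 (x.2 i))) := by fun_prop
  have hS : MeasurableSet
      {x : Ω₀ × (∀ i, Y i) | ∀ i, (γ i).1 (x.2 i) ∈ B i} := by
    rw [Set.ofPred_forall]
    refine MeasurableSet.iInter fun i => ?_
    have : Measurable fun x : Ω₀ × (∀ i, Y i) => (γ i).1 (x.2 i) := by fun_prop
    exact this (hB i)
  have hfun : (fun x : Ω₀ × (∀ i, Y i) =>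
      ∏ i, ((γ i).1 ⁻¹' B i).indicator (fun _ => (1 : ℝ≥0∞)) (x.2 i)) =
      {x : Ω₀ × (∀ i, Y i) | ∀ i, (γ i).1 (x.2 i) ∈ B i}.indicator 1 := by
    funext x
    by_cases h : ∀ i, (γ i).1 (x.2 i) ∈ B i
    · rw [Set.indicator_of_mem (by exact h)]
      exact Finset.prod_eq_one fun i _ => Set.indicator_of_mem (by exact h i) _
    · rw [Set.indicator_of_notMem (by exact h)]
      push Not at h
      obtain ⟨i, hi⟩ := h
      exact Finset.prod_eq_zero (Finset.mem_univ i) (Set.indicator_of_notMem (by exact hi) _)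
  rw [hfun, lintegral_indicator_one hS, Measure.restrict_apply hS, strategicMeasure,
    Measure.map_apply hm]
  · congr 1
    ext x
    simp only [Set.mem_preimage, Set.mem_prod, Set.mem_pi, Set.mem_univ, true_imp_iff,
      Set.mem_inter_iff, Set.mem_ofPred_eq, forall_and]
    tauto
  · exact hB₀.prod (MeasurableSet.univ_pi fun i => (hA i).prod (hB i))

/-- The cost `∫ P(ds) c(s)` of a measure `P` on `Ω₀ × ∏ₖ (Yᵏ × Uᵏ)`. -/
def measureCost (T : StaticTeam Ω₀ Y U) (P : Measure (Ω₀ × ∀ i, Y i × U i)) : ℝ≥0∞ :=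
  ∫⁻ s, (T.c s.1 (fun i => (s.2 i).1) (fun i => (s.2 i).2) : ℝ≥0∞) ∂P

/-- The set of strategic measures induced by the admissible strategies. -/
def strategicMeasures (T : StaticTeam Ω₀ Y U) : Set (Measure (Ω₀ × ∀ i, Y i × U i)) :=
  Set.range T.strategicMeasure

/-- The strategic measures whose action marginal is carried by the product set `∏ᵢ Gⁱ`
(for closed `G`: whose support on the action spaces is contained in `∏ᵢ Gⁱ`). -/
def strategicMeasuresOn (T : StaticTeam Ω₀ Y U) (G : ∀ i, Set (U i)) :
    Set (Measure (Ω₀ × ∀ i, Y i × U i)) :=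
  {P | P ∈ T.strategicMeasures ∧ ∀ᵐ s ∂P, ∀ i, (s.2 i).2 ∈ G i}

/-- `P` is `δ`-optimal for the team within the class `C` of measures
(`δ = 0`: optimal within the class). -/
def IsNearOptimalIn (T : StaticTeam Ω₀ Y U) (C : Set (Measure (Ω₀ × ∀ i, Y i × U i)))
    (δ : ℝ≥0) (P : Measure (Ω₀ × ∀ i, Y i × U i)) : Prop :=
  P ∈ C ∧ ∀ P' ∈ C, T.measureCost P ≤ T.measureCost P' + δ

/-- `w_G(ω₀, y) = sup_{u ∈ G} c(ω₀, y, u)` for the product set `G = ∏ᵢ Gⁱ`. -/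
def supCost (T : StaticTeam Ω₀ Y U) (G : ∀ i, Set (U i)) (x : Ω₀ × ∀ i, Y i) : ℝ≥0∞ :=
  ⨆ u ∈ Set.univ.pi G, (T.c x.1 x.2 u : ℝ≥0∞)

/-- The strategy obtained from `γ` when decision maker `k` plays the constant action `u`. -/
def Strategy.setConst {T : StaticTeam Ω₀ Y U} (γ : T.Strategy) (k : Fin N) (u : U k) :
    T.Strategy :=
  Function.update γ k ⟨fun _ => u, measurable_const⟩

end

end StaticTeam

/-- The quantizers of one measurement space: an exhaustion by compact sets `K l`, finite nets in
them (`net l n` is a `1/(n+1)`-net of `K l`), measurable nearest-neighbour maps `q l n`, and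
auxiliary points `y₀ l n` to which everything outside `K l` is sent. Both indices start at `0`. -/
structure QuantizationScheme (Y : Type*) [MetricSpace Y] [MeasurableSpace Y] where
  K : ℕ → Set Y
  isCompact_K : ∀ l, IsCompact (K l)
  K_subset_interior : ∀ l, K l ⊆ interior (K (l + 1))
  iUnion_K : ⋃ l, K l = Set.univ
  net : ℕ → ℕ → Finset Y
  net_subset : ∀ l n, (net l n : Set Y) ⊆ K l
  net_dense : ∀ l n, ∀ y ∈ K l, ∃ z ∈ net l n, dist y z < 1 / ((n : ℝ) + 1)
  q : ∀ l n, K l → net l n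
  measurable_q : ∀ l n, Measurable (q l n)
  q_nearest : ∀ l n (y : K l), ∀ z ∈ net l n, dist (y : Y) (q l n y) ≤ dist (y : Y) z
  y₀ : ℕ → ℕ → Y

namespace QuantizationScheme

variable {Y : Type*} [MetricSpace Y] [MeasurableSpace Y]

/-- The finite set of output levels of the quantizer, including the auxiliary level. -/
def levels (S : QuantizationScheme Y) (l n : ℕ) : Set Y :=
  insert (S.y₀ l n) (S.net l n : Set Y)

open Classical in
/-- The quantizer: the nearest net point on `K l`, the auxiliary level elsewhere. -/
def Q (S : QuantizationScheme Y) (l n : ℕ) (y : Y) : S.levels l n :=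
  if h : y ∈ S.K l then ⟨S.q l n ⟨y, h⟩, Set.mem_insert_of_mem _ (S.q l n ⟨y, h⟩).2⟩
  else ⟨S.y₀ l n, Set.mem_insert _ _⟩

theorem measurable_Q [BorelSpace Y] (S : QuantizationScheme Y) (l n : ℕ) :
    Measurable (S.Q l n) := by
  classical
  have h1 : Measurable fun y : S.K l =>
      (⟨S.q l n y, Set.mem_insert_of_mem _ (S.q l n y).2⟩ : S.levels l n) :=
    (measurable_subtype_coe.comp (S.measurable_q l n)).subtype_mk
  have h2 : Measurable fun _ : ((S.K l)ᶜ : Set Y) =>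
      (⟨S.y₀ l n, Set.mem_insert _ _⟩ : S.levels l n) := measurable_const
  have h := Measurable.dite h1 h2 (S.isCompact_K l).isClosed.measurableSet
  unfold Q
  convert h

end QuantizationScheme

namespace StaticTeam

variable {N : ℕ} {Ω₀ : Type*} [MeasurableSpace Ω₀] {Y : Fin N → Type*}
  [∀ i, MetricSpace (Y i)] [∀ i, MeasurableSpace (Y i)] [∀ i, BorelSpace (Y i)]
  {U : Fin N → Type*} [∀ i, MeasurableSpace (U i)]

/-- The finite-measurement `(l, n)` team: the measurement spaces are the finite sets of quantizer
outputs, the channels are the push-forwards of the original channels under the quantizers, and the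
cost is the original cost restricted to the quantized measurements. -/
def quantized (T : StaticTeam Ω₀ Y U) (S : ∀ i, QuantizationScheme (Y i)) (l n : ℕ) :
    StaticTeam Ω₀ (fun i => (S i).levels l n) U where
  prior := T.prior
  isProbabilityMeasure_prior := inferInstance
  channel i := (T.channel i).map ((S i).Q l n)
  isMarkovKernel_channel i := Kernel.IsMarkovKernel.map _ ((S i).measurable_Q l n)
  c ω z u := T.c ω (fun i => (z i : Y i)) u
  measurable_c := by
    have h : Measurable fun s : Ω₀ × (∀ i, (S i).levels l n) × (∀ i, U i) =>
        (s.1, (fun i => ((s.2.1 i : (S i).levels l n) : Y i)), s.2.2) := by fun_prop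
    exact T.measurable_c.comp h

/-- The extension `γⁱ ∘ Qⁱ` of a strategy of the `(l, n)` team to the original team. -/
def extend (T : StaticTeam Ω₀ Y U) (S : ∀ i, QuantizationScheme (Y i)) (l n : ℕ)
    (φ : (T.quantized S l n).Strategy) : T.Strategy :=
  fun i => ⟨(φ i).1 ∘ (S i).Q l n, (φ i).2.comp ((S i).measurable_Q l n)⟩

end StaticTeam

end

/-! Two comparisons between the original team and the diagonal team `l = n = m` carry the proof.
Both rest on the pointwise convergence `Q m m y → y` (`tendsto_Q`) and on the law of the quantized
team being the image of the original law (`quantized_law`), so that all costs become integrals over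
one probability space.

Extension (`eventually_J_extend_le`) is uniform over all policies with values in `G`: the loss at
`x` is at most the supremum over `u ∈ G` of the drop of the cost from `y` to `Q y`. This tends to
zero by compactness of `G` and is dominated by `w_G`.

Restriction (`eventually_J_restrictLevels_le`) concerns one fixed nearly optimal strategy. The
levels may form a null set, on which a merely measurable strategy is arbitrary. The strategy is
therefore first made continuous at almost every measurement, so that its values at `Q y` converge to
its value at `y`. The costs at `Q y` have no common integrable bound, and uniform integrability of
`w_G` under the quantized laws replaces it.

Such a strategy exists in two steps. Tightness on Polish action spaces and the switch to constant
actions give compact action sets (`exists_strategy_mem_isCompact`). Simple functions are then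
reglued along open sets with null frontier, which keeps the values in `G`
(`exists_strategy_ae_continuousAt`).

An optimal element exists because, with finitely many measurements, policies into `G` form a compact
product on which the cost is continuous (`exists_isNearOptimalIn_zero`). -/

/-! ### Almost everywhere continuous approximation -/

/-- A measurable set is approximated in measure by open sets with null frontier. -/
theorem exists_isOpen_null_frontier_symmDiff_lt {X : Type*} [PseudoMetricSpace X]
    [MeasurableSpace X] [BorelSpace X] (ν : Measure X) [IsFiniteMeasure ν] {s : Set X}
    (hs : MeasurableSet s) {η : ℝ≥0∞} (hη : η ≠ 0) :
    ∃ D : Set X, IsOpen D ∧ ν (frontier D) = 0 ∧ ν (symmDiff s D) < η := by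
  have hη2 : η / 2 ≠ 0 := (ENNReal.half_pos hη).ne'
  -- Thickenings of a closed inner approximation shrink to it in measure, and arbitrarily small
  -- radii give null frontiers.
  obtain ⟨F, hFs, hF, hFlt⟩ := hs.exists_isClosed_sdiff_lt (measure_ne_top ν s) hη2
  obtain ⟨rs, hrs, hrs'⟩ := exists_null_frontiers_thickening ν F
  have h1 : Tendsto (fun n => ν (Metric.thickening (rs n) F)) atTop (𝓝 (ν F)) := by
    refine (tendsto_measure_thickening_of_isClosed ⟨1, one_pos, measure_ne_top _ _⟩ hF).comp ?_
    exact tendsto_nhdsWithin_iff.2 ⟨hrs, Eventually.of_forall fun n => (hrs' n).1⟩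
  have h2 : ∀ᶠ n in atTop, ν (Metric.thickening (rs n) F) < ν F + η / 2 :=
    h1.eventually_lt_const (ENNReal.lt_add_right (measure_ne_top _ _) hη2)
  obtain ⟨n, hn⟩ := h2.exists
  refine ⟨Metric.thickening (rs n) F, Metric.isOpen_thickening, (hrs' n).2, ?_⟩
  have hsub : F ⊆ Metric.thickening (rs n) F := Metric.self_subset_thickening (hrs' n).1 F
  have h3 : ν (Metric.thickening (rs n) F \ F) < η / 2 := by
    rw [measure_sdiff hsub hF.measurableSet.nullMeasurableSet (measure_ne_top _ _)]
    exact ENNReal.sub_lt_of_lt_add (measure_mono hsub) (by rwa [add_comm] at hn)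
  calc ν (symmDiff s (Metric.thickening (rs n) F))
      ≤ ν ((s \ F) ∪ (Metric.thickening (rs n) F \ F)) := by
        refine measure_mono ?_
        rintro x (⟨hx, hx'⟩ | ⟨hx, hx'⟩)
        · exact Or.inl ⟨hx, fun h => hx' (hsub h)⟩
        · exact Or.inr ⟨hx, fun h => hx' (hFs h)⟩
    _ ≤ ν (s \ F) + ν (Metric.thickening (rs n) F \ F) := measure_union_le _ _
    _ < η / 2 + η / 2 := ENNReal.add_lt_add hFlt h3
    _ = η := ENNReal.add_halves η

/-- A simple function agrees, up to a set of small measure, with a measurable function that is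
continuous at almost every point. -/
theorem SimpleFunc.exists_ae_continuousAt {X B : Type*} [PseudoMetricSpace X]
    [MeasurableSpace X] [BorelSpace X] [TopologicalSpace B] [MeasurableSpace B] [Nonempty B]
    (ν : Measure X) [IsFiniteMeasure ν] (f : SimpleFunc X B) :
    ∀ η : ℝ≥0∞, η ≠ 0 → ∃ g : X → B, Measurable g ∧ (∀ᵐ x ∂ν, ContinuousAt g x) ∧
      ν {x | f x ≠ g x} < η := by
  classical
  induction f using SimpleFunc.induction' with
  | const c =>
    intro η hη
    exact ⟨fun _ => c, measurable_const, ae_of_all _ fun _ => continuousAt_const,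
      by simpa using pos_iff_ne_zero.2 hη⟩
  | pcw hs hf₁ hf₂ =>
    rename_i f₁ f₂ s
    intro η hη
    -- One third for each of the two pieces, one for the change of the gluing set.
    have hη3 : η / 3 ≠ 0 := by simpa using hη
    obtain ⟨g₁, hg₁, hc₁, hν₁⟩ := hf₁ _ hη3
    obtain ⟨g₂, hg₂, hc₂, hν₂⟩ := hf₂ _ hη3
    obtain ⟨D, hD, hDf, hDs⟩ := exists_isOpen_null_frontier_symmDiff_lt ν hs hη3
    refine ⟨D.piecewise g₁ g₂, hg₁.piecewise hD.measurableSet hg₂, ?_, ?_⟩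
    · have h0 : ∀ᵐ x ∂ν, x ∉ frontier D := by
        rw [ae_iff]; simpa using hDf
      -- Off the frontier of `D`, the glued function coincides near `x` with one of the two pieces.
      filter_upwards [hc₁, hc₂, h0] with x h1 h2 hx
      by_cases hxD : x ∈ D
      · refine h1.congr ?_
        filter_upwards [hD.mem_nhds hxD] with y hy
        exact (Set.piecewise_eq_of_mem _ _ _ hy).symm
      · have hxD' : x ∈ (closure D)ᶜ := fun h => hx ⟨h, fun h' => hxD (interior_subset h')⟩
        refine h2.congr ?_
        filter_upwards [isClosed_closure.isOpen_compl.mem_nhds hxD'] with y hy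
        exact (Set.piecewise_eq_of_notMem _ _ _ fun h => hy (subset_closure h)).symm
    · calc ν {x | (f₁.piecewise s hs f₂) x ≠ D.piecewise g₁ g₂ x}
          ≤ ν (({x | f₁ x ≠ g₁ x} ∪ {x | f₂ x ≠ g₂ x}) ∪ symmDiff s D) := by
            refine measure_mono fun x hx => ?_
            by_contra hcon
            simp only [Set.mem_union, Set.mem_ofPred_eq, not_or, not_not, Set.mem_symmDiff,
              not_and] at hcon hx
            obtain ⟨⟨e1, e2⟩, e3, e4⟩ := hcon
            apply hx
            by_cases hxs : x ∈ s
            · simp [SimpleFunc.coe_piecewise, hxs, e3 hxs, e1]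
            · have hxD : x ∉ D := fun h => hxs (e4 h)
              simp [SimpleFunc.coe_piecewise, hxs, hxD, e2]
        _ ≤ ν {x | f₁ x ≠ g₁ x} + ν {x | f₂ x ≠ g₂ x} + ν (symmDiff s D) :=
            (measure_union_le _ _).trans (by gcongr; exact measure_union_le _ _)
        _ < η / 3 + η / 3 + η / 3 := by gcongr
        _ = η := ENNReal.add_thirds η

/-- A finite measure on a Polish space charges the complement of some compact set as little as
wanted, also after a measurable change of variables. -/
theorem exists_isCompact_measure_notMem_lt {X B : Type*} [MeasurableSpace X]
    [TopologicalSpace B] [PolishSpace B] [MeasurableSpace B] [BorelSpace B]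
    (ν : Measure X) [IsFiniteMeasure ν] {f : X → B} (hf : Measurable f) {η : ℝ≥0∞}
    (hη : η ≠ 0) : ∃ K : Set B, IsCompact K ∧ ν {x | f x ∉ K} < η := by
  have ht := isTightMeasureSet_singleton (μ := ν.map f)
  rw [isTightMeasureSet_iff_exists_isCompact_measure_compl_le] at ht
  obtain ⟨η', h0, h1⟩ := exists_between (pos_iff_ne_zero.2 hη)
  obtain ⟨K, hK, hKc⟩ := ht η' h0
  refine ⟨K, hK, lt_of_le_of_lt ?_ h1⟩
  have := hKc _ rfl
  rwa [Measure.map_apply hf hK.isClosed.measurableSet.compl] at this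

/-! ### Convergence of the diagonal quantizers -/

namespace QuantizationScheme

variable {Y : Type*} [MetricSpace Y] [MeasurableSpace Y]

theorem monotone_K (S : QuantizationScheme Y) : Monotone S.K :=
  monotone_nat_of_le_succ fun l => (S.K_subset_interior l).trans interior_subset

/-- A point lies in `K m` for all large `m`, and from then on its nearest net point is within `1 /
(m + 1)`. -/
theorem tendsto_Q (S : QuantizationScheme Y) (y : Y) :
    Tendsto (fun m => (S.Q m m y : Y)) atTop (𝓝 y) := by
  obtain ⟨l, hl⟩ := Set.mem_iUnion.1 (S.iUnion_K.symm ▸ Set.mem_univ y)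
  rw [tendsto_iff_dist_tendsto_zero]
  refine squeeze_zero' (Eventually.of_forall fun _ => dist_nonneg) ?_
    (tendsto_one_div_add_atTop_nhds_zero_nat (𝕜 := ℝ))
  filter_upwards [eventually_ge_atTop l] with m hm
  have hy : y ∈ S.K m := S.monotone_K hm hl
  obtain ⟨z, hz, hyz⟩ := S.net_dense m m y hy
  rw [dist_comm, Q, dif_pos hy]
  exact (S.q_nearest m m ⟨y, hy⟩ z hz).trans hyz.le

instance finite_levels (S : QuantizationScheme Y) (l n : ℕ) : Finite (S.levels l n) :=
  ((S.net l n).finite_toSet.insert _).to_subtype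

end QuantizationScheme

/-! ### Suprema of continuous families -/

/-- Continuity in `u` reduces the supremum to a countable dense subset of `s`, because a bound valid
there holds on a closed set. -/
theorem measurable_biSup_of_continuous {X V : Type*} [MeasurableSpace X] [TopologicalSpace V]
    [SecondCountableTopology V] {f : X → V → ℝ≥0} (hf : ∀ u, Measurable fun x => f x u)
    (hc : ∀ x, Continuous (f x)) (s : Set V) :
    Measurable fun x => ⨆ u ∈ s, (f x u : ℝ≥0∞) := by
  obtain ⟨t, htc, htd⟩ := TopologicalSpace.exists_countable_dense s
  have heq : ∀ x, ⨆ u ∈ s, (f x u : ℝ≥0∞) = ⨆ u ∈ t, (f x (u : s) : ℝ≥0∞) := by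
    intro x
    refine le_antisymm (iSup₂_le fun u hu => ?_)
      (iSup₂_le fun u _ => le_iSup₂ (f := fun u (_ : u ∈ s) => (f x u : ℝ≥0∞)) u.1 u.2)
    have hcl : IsClosed {v : s | (f x v : ℝ≥0∞) ≤ ⨆ u ∈ t, (f x (u : s) : ℝ≥0∞)} :=
      isClosed_le (ENNReal.continuous_coe.comp ((hc x).comp continuous_subtype_val))
        continuous_const
    have hsub : closure t ⊆ {v : s | (f x v : ℝ≥0∞) ≤ ⨆ u ∈ t, (f x (u : s) : ℝ≥0∞)} :=
      closure_minimal
        (fun v hv => le_iSup₂ (f := fun (u : s) (_ : u ∈ t) => (f x u : ℝ≥0∞)) v hv) hcl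
    exact hsub (htd ⟨u, hu⟩)
  simp_rw [heq]
  exact Measurable.biSup t htc fun u _ => (hf u).coe_nnreal_ennreal

/-- The largest drop of a jointly continuous function over a compact set of second arguments
tends to zero. -/
theorem tendsto_biSup_sub_of_isCompact {X V : Type*} [TopologicalSpace X] [TopologicalSpace V]
    {f : X → V → ℝ≥0} (hf : Continuous fun p : X × V => f p.1 p.2) {G : Set V}
    (hG : IsCompact G) {x : X} {xs : ℕ → X} (hx : Tendsto xs atTop (𝓝 x)) :
    Tendsto (fun m => ⨆ u ∈ G, ((f x u - f (xs m) u : ℝ≥0) : ℝ≥0∞)) atTop (𝓝 0) := by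
  refine ENNReal.tendsto_nhds_zero.2 fun η hη => ?_
  obtain ⟨r, hr0, hrη⟩ := ENNReal.lt_iff_exists_nnreal_btwn.1 hη
  have hF : Continuous fun p : X × V => f x p.2 - f p.1 p.2 :=
    (hf.comp (continuous_const.prodMk continuous_snd)).sub hf
  -- The truncated difference vanishes at `x' = x` for every `u`; compactness of `G` makes the
  -- neighbourhood independent of `u`.
  have h : ∀ᶠ x' in 𝓝 x, ∀ u ∈ G, f x u - f x' u < r := by
    refine hG.eventually_forall_of_forall_eventually fun u _ => ?_
    refine hF.continuousAt.eventually_lt continuousAt_const ?_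
    simpa using hr0
  filter_upwards [hx.eventually h] with m hm
  exact iSup₂_le fun u hu => (ENNReal.coe_le_coe.2 (hm u hu).le).trans hrη.le

/-! ### Costs of strategies and dominated convergence -/

namespace StaticTeam

section

variable {N : ℕ} {Ω₀ : Type*} [MeasurableSpace Ω₀] {Y : Fin N → Type*}
  [∀ i, MeasurableSpace (Y i)] {U : Fin N → Type*} [∀ i, MeasurableSpace (U i)]

instance isProbabilityMeasure_law (T : StaticTeam Ω₀ Y U) : IsProbabilityMeasure T.law := by
  unfold law; infer_instance

theorem measurable_cost_comp (T : StaticTeam Ω₀ Y U) {X : Type*} [MeasurableSpace X] {a : X → Ω₀}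
    {b : X → ∀ i, Y i} {d : X → ∀ i, U i} (ha : Measurable a) (hb : Measurable b)
    (hd : Measurable d) : Measurable fun x => T.c (a x) (b x) (d x) :=
  T.measurable_c.comp (ha.prodMk (hb.prodMk hd))

theorem measurable_cost_strategy (T : StaticTeam Ω₀ Y U) (γ : T.Strategy) :
    Measurable fun x : Ω₀ × ∀ i, Y i => T.c x.1 x.2 (fun i => (γ i).1 (x.2 i)) := by
  have hγ : ∀ i, Measurable (γ i).1 := fun i => (γ i).2
  exact T.measurable_cost_comp measurable_fst measurable_snd (by fun_prop)

theorem measurable_strategicMeasure_map (T : StaticTeam Ω₀ Y U) (γ : T.Strategy) :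
    Measurable fun x : Ω₀ × ∀ i, Y i => (x.1, fun i => (x.2 i, (γ i).1 (x.2 i))) := by
  have hγ : ∀ i, Measurable (γ i).1 := fun i => (γ i).2
  fun_prop

theorem measureCost_strategicMeasure (T : StaticTeam Ω₀ Y U) (γ : T.Strategy) :
    T.measureCost (T.strategicMeasure γ) = T.J γ := by
  rw [measureCost, strategicMeasure, lintegral_map _ (T.measurable_strategicMeasure_map γ)]
  · rfl
  · exact (T.measurable_cost_comp measurable_fst (by fun_prop) (by fun_prop)).coe_nnreal_ennreal

theorem cost_le_supCost (T : StaticTeam Ω₀ Y U) {G : ∀ i, Set (U i)} (x : Ω₀ × ∀ i, Y i)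
    {u : ∀ i, U i} (hu : ∀ i, u i ∈ G i) : (T.c x.1 x.2 u : ℝ≥0∞) ≤ T.supCost G x :=
  le_iSup₂ (f := fun u (_ : u ∈ Set.univ.pi G) => (T.c x.1 x.2 u : ℝ≥0∞)) u fun i _ => hu i

/-- Membership in `strategicMeasuresOn` in terms of the strategy. -/
theorem strategicMeasure_mem_strategicMeasuresOn_iff (T : StaticTeam Ω₀ Y U)
    {G : ∀ i, Set (U i)} (hG : ∀ i, MeasurableSet (G i)) (γ : T.Strategy) :
    T.strategicMeasure γ ∈ T.strategicMeasuresOn G ↔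
      ∀ᵐ x ∂T.law, ∀ i, (γ i).1 (x.2 i) ∈ G i := by
  have hS : MeasurableSet {s : Ω₀ × ∀ i, Y i × U i | ∀ i, (s.2 i).2 ∈ G i} := by
    rw [Set.ofPred_forall]
    refine MeasurableSet.iInter fun i => ?_
    have : Measurable fun s : Ω₀ × (∀ i, Y i × U i) => (s.2 i).2 := by fun_prop
    exact this (hG i)
  rw [strategicMeasuresOn, Set.mem_ofPred_eq, strategicMeasure,
    ae_map_iff (T.measurable_strategicMeasure_map γ).aemeasurable hS]
  exact and_iff_right ⟨γ, rfl⟩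

/-- If `γ'` agrees with `γ` off a set `B`, its cost exceeds that of `γ` by at most the integral
over `B` of a bound for its running cost. -/
theorem J_le_add_setLIntegral (T : StaticTeam Ω₀ Y U) (γ γ' : T.Strategy)
    {w : Ω₀ × (∀ i, Y i) → ℝ≥0∞} {B : Set (Ω₀ × ∀ i, Y i)} (hB : MeasurableSet B)
    (hon : ∀ x ∈ B, (T.c x.1 x.2 (fun i => (γ' i).1 (x.2 i)) : ℝ≥0∞) ≤ w x)
    (hoff : ∀ x ∉ B, ∀ i, (γ' i).1 (x.2 i) = (γ i).1 (x.2 i)) :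
    T.J γ' ≤ T.J γ + ∫⁻ x in B, w x ∂T.law := by
  rw [← lintegral_indicator hB, J, J,
    ← lintegral_add_left (T.measurable_cost_strategy γ).coe_nnreal_ennreal]
  refine lintegral_mono fun x => ?_
  by_cases hx : x ∈ B
  · rw [Set.indicator_of_mem hx]
    exact (hon x hx).trans le_add_self
  · rw [Set.indicator_of_notMem hx, add_zero]
    simp only [hoff x hx, le_refl]

variable [∀ i, TopologicalSpace (U i)]

theorem measurable_supCost [∀ i, SecondCountableTopology (U i)] (T : StaticTeam Ω₀ Y U)
    (hc : ∀ ω y, Continuous (T.c ω y)) (G : ∀ i, Set (U i)) :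
    Measurable (T.supCost G) :=
  measurable_biSup_of_continuous (f := fun x : Ω₀ × ∀ i, Y i => T.c x.1 x.2)
    (fun _ => T.measurable_cost_comp measurable_fst measurable_snd measurable_const)
    (fun x => hc x.1 x.2) _

/-- Costs of strategies with values in `G` converge when the strategies converge almost surely. -/
theorem tendsto_J_of_tendsto_ae (T : StaticTeam Ω₀ Y U) (hc : ∀ ω y, Continuous (T.c ω y))
    {G : ∀ i, Set (U i)} (hG : ∫⁻ x, T.supCost G x ∂T.law ≠ ∞) {ι : Type*} {l : Filter ι}
    [l.IsCountablyGenerated] {γs : ι → T.Strategy} {γ : T.Strategy}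
    (hγG : ∀ᶠ k in l, ∀ᵐ x ∂T.law, ∀ i, (γs k i).1 (x.2 i) ∈ G i)
    (hlim : ∀ᵐ x ∂T.law, ∀ i, Tendsto (fun k => (γs k i).1 (x.2 i)) l (𝓝 ((γ i).1 (x.2 i)))) :
    Tendsto (fun k => T.J (γs k)) l (𝓝 (T.J γ)) := by
  refine tendsto_lintegral_filter_of_dominated_convergence (T.supCost G)
    (Eventually.of_forall fun k => (T.measurable_cost_strategy (γs k)).coe_nnreal_ennreal)
    ?_ hG ?_
  · filter_upwards [hγG] with k hk
    filter_upwards [hk] with x hx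
    exact T.cost_le_supCost x hx
  · filter_upwards [hlim] with x hx
    exact ENNReal.tendsto_coe.2 (((hc x.1 x.2).tendsto _).comp (tendsto_pi_nhds.2 hx))

end

end StaticTeam

namespace StaticTeam

section

variable {N : ℕ} {Ω₀ : Type*} [MeasurableSpace Ω₀] {Y : Fin N → Type*}
  [∀ i, MeasurableSpace (Y i)] {U : Fin N → Type*} [∀ i, MeasurableSpace (U i)]
  [∀ i, TopologicalSpace (U i)] [∀ i, PolishSpace (U i)] [∀ i, BorelSpace (U i)]

/-! ### Reduction to continuous strategies with compact action sets -/

/-- A strategy of finite cost can be truncated to compact action sets at small extra cost. -/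
theorem exists_strategy_mem_isCompact (T : StaticTeam Ω₀ Y U)
    (hconst : ∀ γ : T.Strategy, T.J γ < ∞ → ∀ k, ∃ u : U k, T.J (γ.setConst k u) < ∞)
    {γ : T.Strategy} (hγ : T.J γ < ∞) (s : Finset (Fin N)) :
    ∀ η : ℝ≥0, 0 < η → ∃ γ' : T.Strategy, T.J γ' ≤ T.J γ + η ∧
      ∀ k ∈ s, ∃ G : Set (U k), IsCompact G ∧ ∀ y, (γ' k).1 y ∈ G := by
  classical
  induction s using Finset.induction with
  | empty => exact fun η _ => ⟨γ, le_self_add, by simp⟩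
  | insert k s hks ih =>
    intro η hη
    obtain ⟨γ₁, hJ₁, hG₁⟩ := ih (η / 2) (half_pos hη)
    -- The decision makers are truncated one at a time: `hconst` applies to a strategy of finite
    -- cost, here the one truncated so far.
    have hJ₁fin : T.J γ₁ < ∞ := hJ₁.trans_lt (ENNReal.add_lt_top.2 ⟨hγ, ENNReal.coe_lt_top⟩)
    obtain ⟨u, hu⟩ := hconst γ₁ hJ₁fin k
    -- Absolute continuity of the integral: events of probability below `r` contribute less than `η
    -- / 2` to the cost of the strategy with constant `u`. Off the compact set `K` the new strategy
    -- is exactly that one.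
    obtain ⟨r, hr, hru⟩ := exists_pos_setLIntegral_lt_of_measure_lt hu.ne
      (ENNReal.coe_ne_zero.2 (half_pos hη).ne')
    have hmeas : Measurable fun x : Ω₀ × (∀ i, Y i) => (γ₁ k).1 (x.2 k) :=
      (γ₁ k).2.comp (by fun_prop)
    obtain ⟨K, hK, hKr⟩ := exists_isCompact_measure_notMem_lt T.law hmeas hr.ne'
    have hKm : MeasurableSet K := hK.isClosed.measurableSet
    have hpm : Measurable (((γ₁ k).1 ⁻¹' K).piecewise (γ₁ k).1 fun _ => u) :=
      (γ₁ k).2.piecewise ((γ₁ k).2 hKm) measurable_const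
    set γ₂ : T.Strategy := Function.update γ₁ k ⟨_, hpm⟩ with hγ₂
    refine ⟨γ₂, ?_, ?_⟩
    · have hB : MeasurableSet {x : Ω₀ × (∀ i, Y i) | (γ₁ k).1 (x.2 k) ∉ K} :=
        (hmeas hKm).compl
      have hle : T.J γ₂ ≤ T.J γ₁ + ∫⁻ x in {x | (γ₁ k).1 (x.2 k) ∉ K},
          (T.c x.1 x.2 (fun i => ((γ₁.setConst k u) i).1 (x.2 i)) : ℝ≥0∞) ∂T.law := by
        refine T.J_le_add_setLIntegral γ₁ γ₂ hB (fun x hx => le_of_eq ?_) fun x hx i => ?_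
        · congr 2
          funext i
          by_cases hik : i = k
          · subst hik
            have : x.2 i ∉ (γ₁ i).1 ⁻¹' K := hx
            simp [hγ₂, Strategy.setConst, Set.piecewise_eq_of_notMem _ _ _ this]
          · simp [hγ₂, Strategy.setConst, Function.update_of_ne hik]
        · by_cases hik : i = k
          · subst hik
            have : x.2 i ∈ (γ₁ i).1 ⁻¹' K := not_not.1 hx
            simp [hγ₂, Set.piecewise_eq_of_mem _ _ _ this]
          · simp [hγ₂, Function.update_of_ne hik]
      calc T.J γ₂ ≤ _ := hle
        _ ≤ (T.J γ + (η / 2 : ℝ≥0)) + (η / 2 : ℝ≥0) := add_le_add hJ₁ (hru _ hKr).le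
        _ = T.J γ + η := by rw [add_assoc, ← ENNReal.coe_add, add_halves]
    · intro j hj
      by_cases hjk : j = k
      · subst hjk
        refine ⟨insert u K, hK.insert u, fun y => ?_⟩
        simp only [hγ₂, Function.update_self, Set.piecewise]
        split_ifs with h
        · exact Or.inr h
        · exact Or.inl rfl
      · obtain ⟨G, hG, hyG⟩ := hG₁ j (Finset.mem_of_mem_insert_of_ne hj hjk)
        exact ⟨G, hG, fun y => by simpa [hγ₂, Function.update_of_ne hjk] using hyG y⟩

end

section

variable {N : ℕ} {Ω₀ : Type*} [MeasurableSpace Ω₀] {Y : Fin N → Type*}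
  [∀ i, MetricSpace (Y i)] [∀ i, MeasurableSpace (Y i)] [∀ i, BorelSpace (Y i)]
  {U : Fin N → Type*} [∀ i, MeasurableSpace (U i)]
  [∀ i, TopologicalSpace (U i)] [∀ i, PolishSpace (U i)] [∀ i, BorelSpace (U i)]

/-- A strategy with values in `G` can be replaced by one that is continuous at almost all
measurements, still with values in `G`, at small extra cost. -/
theorem exists_strategy_ae_continuousAt (T : StaticTeam Ω₀ Y U)
    (hc : ∀ ω y, Continuous (T.c ω y)) {G : ∀ i, Set (U i)}
    (hw : ∫⁻ x, T.supCost G x ∂T.law ≠ ∞) {γ : T.Strategy} (hγ : T.J γ ≠ ∞)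
    (hγG : ∀ i y, (γ i).1 y ∈ G i) {η : ℝ≥0} (hη : 0 < η) :
    ∃ γ' : T.Strategy, T.J γ' ≤ T.J γ + η ∧ (∀ i y, (γ' i).1 y ∈ G i) ∧
      ∀ᵐ x ∂T.law, ∀ i, ContinuousAt (γ' i).1 (x.2 i) := by
  obtain ⟨x₀⟩ : Nonempty (Ω₀ × ∀ i, Y i) := nonempty_of_isProbabilityMeasure T.law
  have hne : ∀ i, Nonempty (G i) := fun i => ⟨⟨_, hγG i (x₀.2 i)⟩⟩
  have hη2 : ((η / 2 : ℝ≥0) : ℝ≥0∞) ≠ 0 := ENNReal.coe_ne_zero.2 (half_pos hη).ne'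
  -- The codomain is the subtype `G i`, so the simple approximants and their regluings take values
  -- in `G`.
  have hsm : ∀ i, StronglyMeasurable fun y => (⟨(γ i).1 y, hγG i y⟩ : G i) := fun i =>
    ((γ i).2.subtype_mk (h := hγG i)).stronglyMeasurable
  let γs : ℕ → T.Strategy := fun n i =>
    ⟨fun y => ((hsm i).approx n y : U i),
      measurable_subtype_coe.comp ((hsm i).approx n).measurable⟩
  have hlim : Tendsto (fun n => T.J (γs n)) atTop (𝓝 (T.J γ)) := by
    refine T.tendsto_J_of_tendsto_ae hc hw
      (Eventually.of_forall fun n => ae_of_all _ fun x i => ((hsm i).approx n (x.2 i)).2)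
      (ae_of_all _ fun x i => ?_)
    exact (continuous_subtype_val.tendsto _).comp ((hsm i).tendsto_approx (x.2 i))
  obtain ⟨n, hn⟩ := (hlim.eventually_lt_const (ENNReal.lt_add_right hγ hη2)).exists
  obtain ⟨r, hr, hrw⟩ := exists_pos_setLIntegral_lt_of_measure_lt hw hη2
  -- The budget `r` for the disagreement event is shared among the decision makers.
  obtain ⟨r', hr', hr'r⟩ := ENNReal.exists_pos_sum_of_countable' hr.ne' (Fin N)
  choose g hg hgc hgν using fun i => SimpleFunc.exists_ae_continuousAt
    (T.law.map fun x => x.2 i) ((hsm i).approx n) (r' i) (hr' i).ne'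
  let γ' : T.Strategy := fun i => ⟨fun y => (g i y : U i), measurable_subtype_coe.comp (hg i)⟩
  have hproj : ∀ i, Measurable fun x : Ω₀ × (∀ i, Y i) => x.2 i := fun i => by fun_prop
  refine ⟨γ', ?_, fun i y => (g i y).2, ?_⟩
  -- A measurable hull of the disagreement event, of the same measure.
  · set B : Set (Ω₀ × ∀ i, Y i) :=
      toMeasurable T.law (⋃ i, {x | (hsm i).approx n (x.2 i) ≠ g i (x.2 i)}) with hBdef
    have hBr : T.law B < r := by
      rw [hBdef, measure_toMeasurable]
      calc T.law (⋃ i, {x | (hsm i).approx n (x.2 i) ≠ g i (x.2 i)})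
          ≤ ∑' i, T.law {x | (hsm i).approx n (x.2 i) ≠ g i (x.2 i)} := measure_iUnion_le _
        _ ≤ ∑' i, r' i := by
            refine ENNReal.tsum_le_tsum fun i => ?_
            exact (Measure.le_map_apply (hproj i).aemeasurable
              {y | (hsm i).approx n y ≠ g i y}).trans (hgν i).le
        _ < r := hr'r
    have hle : T.J γ' ≤ T.J (γs n) + ∫⁻ x in B, T.supCost G x ∂T.law := by
      refine T.J_le_add_setLIntegral (γs n) γ' (measurableSet_toMeasurable _ _)
        (fun x _ => T.cost_le_supCost x fun i => (g i (x.2 i)).2) fun x hx i => ?_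
      have hx' : ¬ (hsm i).approx n (x.2 i) ≠ g i (x.2 i) := fun h =>
        hx (subset_toMeasurable _ _ (Set.mem_iUnion.2 ⟨i, h⟩))
      exact congrArg Subtype.val (not_not.1 hx').symm
    calc T.J γ' ≤ _ := hle
      _ ≤ (T.J γ + (η / 2 : ℝ≥0)) + (η / 2 : ℝ≥0) := add_le_add hn.le (hrw _ hBr).le
      _ = T.J γ + η := by rw [add_assoc, ← ENNReal.coe_add, add_halves]
  · rw [ae_all_iff]
    intro i
    filter_upwards [ae_of_ae_map (hproj i).aemeasurable (hgc i)] with x hx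
    exact continuous_subtype_val.continuousAt.comp hx

end

end StaticTeam

/-- The image of a product measure under a coordinatewise map is the product of the images, so
quantizing preserves conditional independence. -/
theorem piKernel_map {N : ℕ} {Ω₀ : Type*} [MeasurableSpace Ω₀] {Y Z : Fin N → Type*}
    [∀ i, MeasurableSpace (Y i)] [∀ i, MeasurableSpace (Z i)] (g : ∀ i, Kernel Ω₀ (Y i))
    [∀ i, IsMarkovKernel (g i)] {q : ∀ i, Y i → Z i} (hq : ∀ i, Measurable (q i))
    [∀ i, IsMarkovKernel ((g i).map (q i))] :
    piKernel (fun i => (g i).map (q i)) = (piKernel g).map fun y i => q i (y i) := by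
  ext1 ω
  have hm : Measurable fun (y : ∀ i, Y i) i => q i (y i) := by fun_prop
  rw [Kernel.map_apply _ hm]
  have : ∀ i, IsProbabilityMeasure ((g i ω).map (q i)) := fun i =>
    Measure.isProbabilityMeasure_map (hq i).aemeasurable
  refine Eq.trans ?_ (Measure.pi_map_pi (μ := fun i => g i ω) fun i => (hq i).aemeasurable).symm
  change Measure.pi _ = _
  simp only [Kernel.map_apply _ (hq _)]

namespace StaticTeam

variable {N : ℕ} {Ω₀ : Type*} [MeasurableSpace Ω₀] {Y : Fin N → Type*}
  [∀ i, MetricSpace (Y i)] [∀ i, MeasurableSpace (Y i)] [∀ i, BorelSpace (Y i)]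
  {U : Fin N → Type*} [∀ i, MeasurableSpace (U i)]

/-! ### The quantized teams -/

theorem measurable_quantize (S : ∀ i, QuantizationScheme (Y i)) (l n : ℕ) :
    Measurable fun x : Ω₀ × (∀ i, Y i) => (x.1, fun i => (S i).Q l n (x.2 i)) := by
  have hQ : ∀ i, Measurable ((S i).Q l n) := fun i => (S i).measurable_Q l n
  fun_prop

/-- This transports every integral over the varying quantized spaces back to the fixed law of `T`.
-/
theorem quantized_law (T : StaticTeam Ω₀ Y U) (S : ∀ i, QuantizationScheme (Y i)) (l n : ℕ) :
    (T.quantized S l n).law = T.law.map fun x => (x.1, fun i => (S i).Q l n (x.2 i)) := by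
  have hQ : ∀ i, Measurable ((S i).Q l n) := fun i => (S i).measurable_Q l n
  have : ∀ i, IsMarkovKernel ((T.channel i).map ((S i).Q l n)) := fun i =>
    Kernel.IsMarkovKernel.map _ (hQ i)
  have h : (T.quantized S l n).law =
      T.prior ⊗ₘ piKernel fun i => (T.channel i).map ((S i).Q l n) := rfl
  rw [h, piKernel_map _ hQ, Measure.compProd_map (by fun_prop)]
  rfl

theorem quantized_J (T : StaticTeam Ω₀ Y U) (S : ∀ i, QuantizationScheme (Y i)) (l n : ℕ)
    (φ : (T.quantized S l n).Strategy) :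
    (T.quantized S l n).J φ = ∫⁻ x, (T.c x.1 (fun i => (S i).Q l n (x.2 i))
      (fun i => (φ i).1 ((S i).Q l n (x.2 i))) : ℝ≥0∞) ∂T.law := by
  rw [J, quantized_law, lintegral_map _ (measurable_quantize S l n)]
  · rfl
  · exact ((T.quantized S l n).measurable_cost_strategy φ).coe_nnreal_ennreal

/-- The restriction of a strategy to the finitely many levels of the quantizers. -/
def restrictLevels (T : StaticTeam Ω₀ Y U) (S : ∀ i, QuantizationScheme (Y i)) (l n : ℕ)
    (γ : T.Strategy) : (T.quantized S l n).Strategy :=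
  fun i => ⟨fun z => (γ i).1 z, (γ i).2.comp measurable_subtype_coe⟩

variable [∀ i, TopologicalSpace (U i)] [∀ i, SecondCountableTopology (U i)]

/-- Uniformly over strategies with actions in a compact set, extending a strategy of a fine
quantized team to the original team increases the cost only slightly. -/
theorem eventually_J_extend_le (T : StaticTeam Ω₀ Y U) (S : ∀ i, QuantizationScheme (Y i))
    (hc : ∀ ω, Continuous fun p : (∀ i, Y i) × (∀ i, U i) => T.c ω p.1 p.2)
    {G : ∀ i, Set (U i)} (hG : ∀ i, IsCompact (G i)) (hw : ∫⁻ x, T.supCost G x ∂T.law ≠ ∞)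
    {η : ℝ≥0∞} (hη : 0 < η) :
    ∀ᶠ m in atTop, ∀ φ : (T.quantized S m m).Strategy,
      (∀ᵐ x ∂(T.quantized S m m).law, ∀ i, (φ i).1 (x.2 i) ∈ G i) →
      T.J (T.extend S m m φ) ≤ (T.quantized S m m).J φ + η := by
  have hcu : ∀ ω y, Continuous (T.c ω y) := fun ω y =>
    (hc ω).comp (continuous_const.prodMk continuous_id)
  have hQ : ∀ m, Measurable fun x : Ω₀ × (∀ i, Y i) => fun i => ((S i).Q m m (x.2 i) : Y i) := by
    intro m
    have hQ : ∀ i, Measurable ((S i).Q m m) := fun i => (S i).measurable_Q m m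
    fun_prop
  -- The worst loss over actions in `G`, independent of the policy. Truncated subtraction bounds it
  -- by `w_G` at the unquantized point, so integrability under the original law suffices.
  let f : ℕ → Ω₀ × (∀ i, Y i) → ℝ≥0∞ := fun m x => ⨆ u ∈ Set.univ.pi G,
    ((T.c x.1 x.2 u - T.c x.1 (fun i => (S i).Q m m (x.2 i)) u : ℝ≥0) : ℝ≥0∞)
  have hfm : ∀ m, Measurable (f m) := fun m => measurable_biSup_of_continuous
    (f := fun (x : Ω₀ × (∀ i, Y i)) u => T.c x.1 x.2 u - T.c x.1 (fun i => (S i).Q m m (x.2 i)) u)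
    (fun u => (T.measurable_cost_comp measurable_fst measurable_snd measurable_const).sub
      (T.measurable_cost_comp measurable_fst (hQ m) measurable_const))
    (fun x => (hcu _ _).sub (hcu _ _)) _
  have hlim : Tendsto (fun m => ∫⁻ x, f m x ∂T.law) atTop (𝓝 (∫⁻ _, 0 ∂T.law)) := by
    refine tendsto_lintegral_of_dominated_convergence (T.supCost G) hfm
      (fun m => ae_of_all _ fun x => ?_) hw (ae_of_all _ fun x => ?_)
    · exact iSup₂_mono fun u _ => ENNReal.coe_le_coe.2 tsub_le_self
    · exact tendsto_biSup_sub_of_isCompact (f := fun y u => T.c x.1 y u) (hc x.1)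
        (isCompact_univ_pi hG) (tendsto_pi_nhds.2 fun i => (S i).tendsto_Q (x.2 i))
  rw [lintegral_zero] at hlim
  filter_upwards [hlim.eventually_lt_const hη] with m hm φ hφ
  rw [quantized_law] at hφ
  have hφ' := ae_of_ae_map (measurable_quantize S m m).aemeasurable hφ
  calc T.J (T.extend S m m φ)
      ≤ ∫⁻ x, ((T.c x.1 (fun i => (S i).Q m m (x.2 i))
          (fun i => (φ i).1 ((S i).Q m m (x.2 i))) : ℝ≥0∞) + f m x) ∂T.law := by
        refine lintegral_mono_ae ?_
        filter_upwards [hφ'] with x hx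
        have h1 := le_iSup₂ (f := fun u (_ : u ∈ Set.univ.pi G) =>
          ((T.c x.1 x.2 u - T.c x.1 (fun i => (S i).Q m m (x.2 i)) u : ℝ≥0) : ℝ≥0∞))
          (fun i => (φ i).1 ((S i).Q m m (x.2 i))) fun i _ => hx i
        refine le_trans ?_ (add_le_add le_rfl h1)
        rw [← ENNReal.coe_add, ENNReal.coe_le_coe]
        exact le_add_tsub
    _ = (T.quantized S m m).J φ + ∫⁻ x, f m x ∂T.law := by
        rw [lintegral_add_right _ (hfm m), ← quantized_J]
    _ ≤ (T.quantized S m m).J φ + η := by gcongr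

/-- If the costs are uniformly integrable over the quantized teams, restricting an almost
everywhere continuous strategy to the levels of fine quantizers increases the cost only
slightly. -/
theorem eventually_J_restrictLevels_le (T : StaticTeam Ω₀ Y U)
    (S : ∀ i, QuantizationScheme (Y i))
    (hc : ∀ ω, Continuous fun p : (∀ i, Y i) × (∀ i, U i) => T.c ω p.1 p.2)
    {G : ∀ i, Set (U i)}
    (hui : Tendsto (fun R : ℝ≥0 => ⨆ (l : ℕ) (n : ℕ),
      ∫⁻ x in {x | (R : ℝ≥0∞) < (T.quantized S l n).supCost G x},
        (T.quantized S l n).supCost G x ∂(T.quantized S l n).law) atTop (𝓝 0))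
    {γ : T.Strategy} (hγG : ∀ i y, (γ i).1 y ∈ G i)
    (hγ : ∀ᵐ x ∂T.law, ∀ i, ContinuousAt (γ i).1 (x.2 i)) {η : ℝ≥0} (hη : 0 < η) :
    ∀ᶠ m in atTop, (T.quantized S m m).J (T.restrictLevels S m m γ) ≤ T.J γ + η := by
  have hcu : ∀ ω y, Continuous (T.c ω y) := fun ω y =>
    (hc ω).comp (continuous_const.prodMk continuous_id)
  have hη2 : (0 : ℝ≥0∞) < (η / 2 : ℝ≥0) := ENNReal.coe_pos.2 (half_pos hη)
  obtain ⟨R, hR⟩ := (hui.eventually_lt_const hη2).exists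
  let W : Ω₀ × (∀ i, Y i) → ℝ≥0∞ := T.supCost G
  have hW : Measurable W := T.measurable_supCost hcu G
  let q : ℕ → Ω₀ × (∀ i, Y i) → Ω₀ × (∀ i, Y i) := fun m x =>
    (x.1, fun i => (S i).Q m m (x.2 i))
  have hq : ∀ m, Measurable (q m) := by
    intro m
    have hQ : ∀ i, Measurable ((S i).Q m m) := fun i => (S i).measurable_Q m m
    fun_prop
  have hcost := T.measurable_cost_strategy γ
  -- The increase of the cost, capped at `R` so that bounded convergence applies.
  let h : ℕ → Ω₀ × (∀ i, Y i) → ℝ≥0 := fun m x =>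
    min (T.c (q m x).1 (q m x).2 (fun i => (γ i).1 ((q m x).2 i)) -
      T.c x.1 x.2 (fun i => (γ i).1 (x.2 i))) R
  have hhm : ∀ m, Measurable (h m) := fun m =>
    ((hcost.comp (hq m)).sub hcost).min measurable_const
  have hlim : Tendsto (fun m => ∫⁻ x, h m x ∂T.law) atTop (𝓝 (∫⁻ _, 0 ∂T.law)) := by
    refine tendsto_lintegral_of_dominated_convergence (fun _ => (R : ℝ≥0∞))
      (fun m => (hhm m).coe_nnreal_ennreal)
      (fun m => ae_of_all _ fun x => ENNReal.coe_le_coe.2 (min_le_right _ _)) (by simp) ?_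
    filter_upwards [hγ] with x hx
    have hy : Tendsto (fun m => (q m x).2) atTop (𝓝 x.2) :=
      tendsto_pi_nhds.2 fun i => (S i).tendsto_Q (x.2 i)
    have hu : Tendsto (fun m => fun i => (γ i).1 ((q m x).2 i)) atTop
        (𝓝 fun i => (γ i).1 (x.2 i)) :=
      tendsto_pi_nhds.2 fun i => (hx i).tendsto.comp ((S i).tendsto_Q (x.2 i))
    have hcx : Tendsto (fun m => T.c x.1 (q m x).2 fun i => (γ i).1 ((q m x).2 i)) atTop
        (𝓝 (T.c x.1 x.2 fun i => (γ i).1 (x.2 i))) :=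
      ((hc x.1).tendsto (x.2, fun i => (γ i).1 (x.2 i))).comp (hy.prodMk_nhds hu)
    have := (hcx.sub (tendsto_const_nhds
      (x := T.c x.1 x.2 fun i => (γ i).1 (x.2 i)))).min (tendsto_const_nhds (x := R))
    rw [tsub_self, min_eq_left zero_le] at this
    simpa only [ENNReal.coe_zero] using ENNReal.tendsto_coe.2 this
  rw [lintegral_zero] at hlim
  filter_upwards [hlim.eventually_lt_const hη2] with m hm
  -- The tail under the original law is the `(m, m)` term of the supremum bounded by the choice of
  -- `R`.
  have htail : ∫⁻ x, {x | (R : ℝ≥0∞) < W (q m x)}.indicator (fun x => W (q m x)) x ∂T.law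
      < (η / 2 : ℝ≥0) := by
    refine lt_of_le_of_lt ?_ hR
    refine le_trans ?_ (le_iSup₂ (f := fun l n =>
      ∫⁻ x in {x | (R : ℝ≥0∞) < (T.quantized S l n).supCost G x},
        (T.quantized S l n).supCost G x ∂(T.quantized S l n).law) m m)
    have hWq : Measurable ((T.quantized S m m).supCost G) := by
      have : Measurable fun x : Ω₀ × (∀ i, (S i).levels m m) =>
          (x.1, fun i => (x.2 i : Y i)) := by fun_prop
      exact hW.comp this
    have hset : MeasurableSet {x | (R : ℝ≥0∞) < (T.quantized S m m).supCost G x} :=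
      measurableSet_lt measurable_const hWq
    rw [← lintegral_indicator hset, quantized_law,
      lintegral_map (hWq.indicator hset) (measurable_quantize S m m)]
    exact le_rfl
  have hWm : Measurable ({x | (R : ℝ≥0∞) < W (q m x)}.indicator fun x => W (q m x)) :=
    (hW.comp (hq m)).indicator (measurableSet_lt measurable_const (hW.comp (hq m)))
  calc (T.quantized S m m).J (T.restrictLevels S m m γ)
      = ∫⁻ x, (T.c (q m x).1 (q m x).2 (fun i => (γ i).1 ((q m x).2 i)) : ℝ≥0∞) ∂T.law :=
        T.quantized_J S m m _
    _ ≤ ∫⁻ x, ((T.c x.1 x.2 (fun i => (γ i).1 (x.2 i)) : ℝ≥0∞) + h m x +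
          {x | (R : ℝ≥0∞) < W (q m x)}.indicator (fun x => W (q m x)) x) ∂T.law := by
        refine lintegral_mono fun x => ?_
        have hle : (T.c (q m x).1 (q m x).2 (fun i => (γ i).1 ((q m x).2 i)) : ℝ≥0∞) ≤
          W (q m x) := T.cost_le_supCost (q m x) fun i => hγG i _
        -- Above level `R` the tail term absorbs the whole cost; below it the cap is inactive.
        by_cases hx : (R : ℝ≥0∞) < W (q m x)
        · rw [Set.indicator_of_mem (by exact hx)]
          exact hle.trans le_add_self
        · have hleR : T.c (q m x).1 (q m x).2 (fun i => (γ i).1 ((q m x).2 i)) ≤ R :=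
            ENNReal.coe_le_coe.1 (hle.trans (not_lt.1 hx))
          refine le_trans ?_ le_self_add
          rw [← ENNReal.coe_add, ENNReal.coe_le_coe]
          simp only [h]
          rw [min_eq_left (tsub_le_self.trans hleR)]
          exact le_add_tsub
    _ = T.J γ + ∫⁻ x, h m x ∂T.law +
          ∫⁻ x, {x | (R : ℝ≥0∞) < W (q m x)}.indicator (fun x => W (q m x)) x ∂T.law := by
        rw [lintegral_add_right _ hWm, lintegral_add_right _ (hhm m).coe_nnreal_ennreal]
        rfl
    _ ≤ T.J γ + (η / 2 : ℝ≥0) + (η / 2 : ℝ≥0) := by gcongr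
    _ = T.J γ + η := by rw [add_assoc, ← ENNReal.coe_add, add_halves]

end StaticTeam

namespace StaticTeam

section

variable {N : ℕ} {Ω₀ : Type*} [MeasurableSpace Ω₀] {Y : Fin N → Type*}
  [∀ i, MeasurableSpace (Y i)] {U : Fin N → Type*} [∀ i, MeasurableSpace (U i)]

/-! ### Optimal strategies of teams with finitely many measurements -/

theorem J_congr_ae (T : StaticTeam Ω₀ Y U) {γ γ' : T.Strategy}
    (h : ∀ᵐ x ∂T.law, ∀ i, (γ i).1 (x.2 i) = (γ' i).1 (x.2 i)) : T.J γ = T.J γ' := by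
  refine lintegral_congr_ae ?_
  filter_upwards [h] with x hx
  simp only [hx]

/-- A team with finitely many measurements has an optimal strategic measure among those with
actions in a given nonempty compact product set. -/
theorem exists_isNearOptimalIn_zero [∀ i, Finite (Y i)] [∀ i, MeasurableSingletonClass (Y i)]
    [∀ i, TopologicalSpace (U i)] [∀ i, FirstCountableTopology (U i)] [∀ i, T2Space (U i)]
    [∀ i, OpensMeasurableSpace (U i)]
    (T : StaticTeam Ω₀ Y U) (hc : ∀ ω y, Continuous (T.c ω y)) {G : ∀ i, Set (U i)}
    (hG : ∀ i, IsCompact (G i)) (hGne : ∀ i, (G i).Nonempty)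
    (hw : ∫⁻ x, T.supCost G x ∂T.law ≠ ∞) :
    ∃ P, T.IsNearOptimalIn (T.strategicMeasuresOn G) 0 P := by
  classical
  choose g hg using hGne
  have hGm : ∀ i, MeasurableSet (G i) := fun i => (hG i).isClosed.measurableSet
  let strat : (∀ i, Y i → U i) → T.Strategy := fun a i => ⟨a i, measurable_of_finite _⟩
  -- On a finite measurement space every function is an admissible policy, so policies into `G` are
  -- the points of this compact product.
  let C : Set (∀ i, Y i → U i) := Set.univ.pi fun i => Set.univ.pi fun _ => G i
  have hC : IsCompact C := isCompact_univ_pi fun i => isCompact_univ_pi fun _ => hG i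
  have hcont : ContinuousOn (fun a => T.J (strat a)) C := by
    intro a _
    refine T.tendsto_J_of_tendsto_ae hc hw (l := 𝓝[C] a) ?_ (ae_of_all _ fun x i => ?_)
    · filter_upwards [self_mem_nhdsWithin] with b hb
      exact ae_of_all _ fun x i => hb i trivial (x.2 i) trivial
    · have : Continuous fun b : ∀ i, Y i → U i => b i (x.2 i) := by fun_prop
      exact this.continuousAt.tendsto.mono_left nhdsWithin_le_nhds
  obtain ⟨a, haC, ha⟩ := hC.exists_isMinOn ⟨fun i _ => g i, fun i _ _ _ => hg i⟩ hcont
  refine ⟨T.strategicMeasure (strat a), (T.strategicMeasure_mem_strategicMeasuresOn_iff hGm _).2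
    (ae_of_all _ fun x i => haC i trivial (x.2 i) trivial), ?_⟩
  rintro P hP
  obtain ⟨φ, rfl⟩ := hP.1
  have hφ := (T.strategicMeasure_mem_strategicMeasuresOn_iff hGm φ).1 hP
  -- A competitor takes values in `G` only almost surely; it is corrected on the other levels at no
  -- cost.
  let b : ∀ i, Y i → U i := fun i y => if (φ i).1 y ∈ G i then (φ i).1 y else g i
  have hb : b ∈ C := by
    intro i _ y _
    by_cases h : (φ i).1 y ∈ G i
    · simpa only [b, if_pos h] using h
    · simpa only [b, if_neg h] using hg i
  rw [measureCost_strategicMeasure, measureCost_strategicMeasure, ENNReal.coe_zero, add_zero]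
  refine (ha hb).trans (T.J_congr_ae ?_).le
  filter_upwards [hφ] with x hx i
  exact if_pos (hx i)

/-- `w_G` is integrable as soon as its integral over some superlevel set is finite. -/
theorem lintegral_supCost_ne_top_of_setLIntegral (T : StaticTeam Ω₀ Y U) {G : ∀ i, Set (U i)}
    (hm : Measurable (T.supCost G)) {R : ℝ≥0}
    (hR : ∫⁻ x in {x | (R : ℝ≥0∞) < T.supCost G x}, T.supCost G x ∂T.law ≠ ∞) :
    ∫⁻ x, T.supCost G x ∂T.law ≠ ∞ := by
  have hset : MeasurableSet {x | (R : ℝ≥0∞) < T.supCost G x} :=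
    measurableSet_lt measurable_const hm
  rw [← lintegral_add_compl _ hset]
  refine ENNReal.add_ne_top.2 ⟨hR, ne_top_of_le_ne_top (ENNReal.coe_ne_top (r := R)) ?_⟩
  calc ∫⁻ x in {x | (R : ℝ≥0∞) < T.supCost G x}ᶜ, T.supCost G x ∂T.law
      ≤ ∫⁻ _ in {x | (R : ℝ≥0∞) < T.supCost G x}ᶜ, (R : ℝ≥0∞) ∂T.law :=
        setLIntegral_mono measurable_const fun x hx => not_lt.1 hx
    _ ≤ ∫⁻ _, (R : ℝ≥0∞) ∂T.law := setLIntegral_le_lintegral _ _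
    _ = R := by simp

end

end StaticTeam

/-! ### The approximation theorem -/

theorem mainTheorem5 {N : ℕ} {Ω₀ : Type*} [TopologicalSpace Ω₀] [MeasurableSpace Ω₀]
    [BorelSpace Ω₀]
    -- measurement spaces: locally compact separable metric spaces
    {Y : Fin N → Type*} [∀ i, MetricSpace (Y i)] [∀ i, LocallyCompactSpace (Y i)]
    [∀ i, SecondCountableTopology (Y i)] [∀ i, MeasurableSpace (Y i)] [∀ i, BorelSpace (Y i)]
    -- action spaces: nonempty closed convex separable subsets `A i` of Fréchet spaces `E i`
    {E : Fin N → Type*} [∀ i, AddCommGroup (E i)] [∀ i, Module ℝ (E i)]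
    [∀ i, TopologicalSpace (E i)] [∀ i, IsTopologicalAddGroup (E i)]
    [∀ i, ContinuousSMul ℝ (E i)] [∀ i, LocallyConvexSpace ℝ (E i)]
    [∀ i, TopologicalSpace.IsCompletelyMetrizableSpace (E i)]
    [∀ i, MeasurableSpace (E i)] [∀ i, BorelSpace (E i)]
    (A : ∀ i, Set (E i)) (hA_nonempty : ∀ i, (A i).Nonempty) (hA_closed : ∀ i, IsClosed (A i))
    (hA_convex : ∀ i, Convex ℝ (A i)) [∀ i, SecondCountableTopology (A i)]
    -- the team and the quantizers
    (T : StaticTeam Ω₀ Y (fun i => A i)) (S : ∀ i, QuantizationScheme (Y i))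
    -- the cost is continuous in `(y, u)` for fixed `ω₀`, and bounded on compact sets
    (hc_cont : ∀ ω, Continuous fun p : (∀ i, Y i) × (∀ i, A i) => T.c ω p.1 p.2)
    (hc_bdd : ∀ C : Set (Ω₀ × (∀ i, Y i) × (∀ i, A i)), IsCompact C →
      ∃ M : ℝ≥0, ∀ s ∈ C, T.c s.1 s.2.1 s.2.2 ≤ M)
    -- `w_G` is integrable for compact product sets `G`
    (hw_int : ∀ G : ∀ i, Set (A i), (∀ i, IsCompact (G i)) →
      ∫⁻ x, T.supCost G x ∂T.law < ∞)
    -- from any finite-cost strategy each decision maker can switch to some constant action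
    -- while keeping the cost finite
    (hconst : ∀ γ : T.Strategy, T.J γ < ∞ → ∀ k, ∃ u : A k, T.J (γ.setConst k u) < ∞)
    -- `w_G` is uniformly integrable with respect to the laws of the quantized teams
    (hw_ui : ∀ G : ∀ i, Set (A i), (∀ i, IsCompact (G i)) →
      Tendsto (fun R : ℝ≥0 => ⨆ (l : ℕ) (n : ℕ),
        ∫⁻ x in {x | (R : ℝ≥0∞) < (T.quantized S l n).supCost G x},
          (T.quantized S l n).supCost G x ∂(T.quantized S l n).law) atTop (𝓝 0))
    -- `ε`: the accuracy for the original team, `δ`: the accuracy for the quantized team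
    (ε δ : ℝ≥0) (hδε : δ < ε) :
    ∃ (l n : ℕ) (G : ∀ i, Set (A i)), (∀ i, IsCompact (G i)) ∧
      (∃ P, (T.quantized S l n).IsNearOptimalIn
        ((T.quantized S l n).strategicMeasuresOn G) 0 P) ∧
      ∀ φ : (T.quantized S l n).Strategy,
        (T.quantized S l n).IsNearOptimalIn ((T.quantized S l n).strategicMeasuresOn G) δ
          ((T.quantized S l n).strategicMeasure φ) →
        T.measureCost (T.strategicMeasure (T.extend S l n φ)) ≤ T.optimalCost + ε := by
  have hpol : ∀ i, PolishSpace (A i) := fun i => by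
    have := (hA_closed i).isCompletelyMetrizableSpace
    exact { }
  have hcu : ∀ ω y, Continuous (T.c ω y) := fun ω y =>
    (hc_cont ω).comp (continuous_const.prodMk continuous_id)
  obtain ⟨x₀⟩ : Nonempty (Ω₀ × ∀ i, Y i) := nonempty_of_isProbabilityMeasure T.law
  -- Five losses of `η`: near optimality, truncation, almost everywhere continuity, restriction to
  -- the levels and extension.
  obtain ⟨η, hη, hηε⟩ : ∃ η : ℝ≥0, 0 < η ∧ δ + (η + η + η + η + η) = ε := by
    refine ⟨(ε - δ) / 5, div_pos (tsub_pos_of_lt hδε) (by norm_num), ?_⟩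
    have h5 : (ε - δ) / 5 + (ε - δ) / 5 + (ε - δ) / 5 + (ε - δ) / 5 + (ε - δ) / 5 = ε - δ := by
      field_simp
      ring
    rw [h5, add_tsub_cancel_of_le hδε.le]
  have hη' : (η : ℝ≥0∞) ≠ 0 := ENNReal.coe_ne_zero.2 hη.ne'
  -- a nearly optimal strategy of the original team
  have hopt : T.optimalCost < ∞ := by
    choose a ha using hA_nonempty
    let γ : T.Strategy := fun i => ⟨fun _ => ⟨a i, ha i⟩, measurable_const⟩
    refine ((iInf_le T.J γ).trans (lintegral_mono fun x => ?_)).trans_lt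
      (hw_int (fun i => {⟨a i, ha i⟩}) fun i => isCompact_singleton)
    exact T.cost_le_supCost x fun i => rfl
  obtain ⟨γ₀, hγ₀⟩ := iInf_lt_iff.1 (ENNReal.lt_add_right hopt.ne hη')
  have hγ₀fin : T.J γ₀ < ∞ :=
    hγ₀.trans (ENNReal.add_lt_top.2 ⟨hopt, ENNReal.coe_lt_top⟩)
  -- truncation to compact action sets
  obtain ⟨γ₁, hγ₁, hγ₁G⟩ := T.exists_strategy_mem_isCompact hconst hγ₀fin Finset.univ η hη
  have hγ₁fin : T.J γ₁ < ∞ :=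
    hγ₁.trans_lt (ENNReal.add_lt_top.2 ⟨hγ₀fin, ENNReal.coe_lt_top⟩)
  choose G hG hγ₁G using fun k => hγ₁G k (Finset.mem_univ k)
  have hw : ∫⁻ x, T.supCost G x ∂T.law ≠ ∞ := (hw_int G hG).ne
  have hui := hw_ui G hG
  -- almost everywhere continuous approximation
  obtain ⟨γ, hγ, hγG, hγc⟩ := T.exists_strategy_ae_continuousAt hcu hw hγ₁fin.ne hγ₁G hη
  -- `G` and `γ` are fixed before `m`; the extension bound covers all `φ` at once, so `m` does not
  -- depend on the policy that will be extended.
  obtain ⟨m, hext, hres⟩ := ((T.eventually_J_extend_le S hc_cont hG hw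
    (pos_iff_ne_zero.2 hη')).and
    (T.eventually_J_restrictLevels_le S hc_cont hui hγG hγc hη)).exists
  have hGm : ∀ i, MeasurableSet (G i) := fun i => (hG i).isClosed.measurableSet
  refine ⟨m, m, G, hG, ?_, fun φ hφ => ?_⟩
  · have hcq : ∀ ω z, Continuous ((T.quantized S m m).c ω z) := fun ω z => hcu ω _
    -- Integrability of `w_G` in the quantized team follows from uniform integrability: some tail is
    -- finite and the rest is at most `R`.
    obtain ⟨R, hR⟩ := (hui.eventually_lt_const ENNReal.zero_lt_top).exists
    refine (T.quantized S m m).exists_isNearOptimalIn_zero hcq hG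
      (fun i => ⟨_, hγG i (x₀.2 i)⟩)
      ((T.quantized S m m).lintegral_supCost_ne_top_of_setLIntegral
        ((T.quantized S m m).measurable_supCost hcq G) (R := R)
        (ne_top_of_lt (lt_of_le_of_lt ?_ hR)))
    exact le_iSup₂ (f := fun l n => ∫⁻ x in {x | (R : ℝ≥0∞) < (T.quantized S l n).supCost G x},
      (T.quantized S l n).supCost G x ∂(T.quantized S l n).law) m m
  · obtain ⟨hφG, hφ⟩ := hφ
    -- The restriction of `γ` takes values in `G`, so it is a competitor for the `δ`-optimal `φ`.
    have hφ1 := hφ _ (((T.quantized S m m).strategicMeasure_mem_strategicMeasuresOn_iff hGm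
      (T.restrictLevels S m m γ)).2 (ae_of_all _ fun x i => hγG i _))
    rw [StaticTeam.measureCost_strategicMeasure, StaticTeam.measureCost_strategicMeasure] at hφ1
    have hφ2 := hext φ
      (((T.quantized S m m).strategicMeasure_mem_strategicMeasuresOn_iff hGm φ).1 hφG)
    rw [StaticTeam.measureCost_strategicMeasure]
    calc T.J (T.extend S m m φ) ≤ (T.quantized S m m).J φ + η := hφ2
      _ ≤ (T.quantized S m m).J (T.restrictLevels S m m γ) + δ + η := by gcongr
      _ ≤ (T.optimalCost + η + η + η + η) + δ + η := by
          gcongr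
          refine hres.trans ?_
          gcongr
          refine hγ.trans ?_
          gcongr
          refine hγ₁.trans ?_
          gcongr
          exact hγ₀.le
      _ = T.optimalCost + ε := by
          rw [← hηε]
          push_cast
          ring
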